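/- All graphs are finite, simple and undirected; $G$ and $G'$ may have different vertex sets, and an edge is identified with its pair of endpoints. **Community tree.** For $k\ge 2$, call two $k$-cliques of $G$ (vertex sets of complete subgraphs with $k$ vertices) adjacent if they share exactly $k-1$ vertices. Each connected component of the resulting graph on the $k$-cliques of $G$ is a $k$-community, and it spans the subgraph that is the union of its cliques. The only $1$-community is $G$ itself. For $1\le l\le k$, a $k$-community is nested in the $l$-community that contains all $l$-cliques contained in cliques of the $k$-community. Communities of different components or of different orders are different nodes, even if they span the same subgraph. With this nesting the communities of all orders form the community tree $T(G)$. A leaf is a community in which no other community is nested. **Persistence diagram.** Each leaf $\ell$ represents a component of the tree, namely the sequence of communities in which $\ell$ is nested. Its birth time $b_\ell$ is the order of $\ell$. Two components merge at the highest order at which they contain the same community. When two components merge, the one with the higher birth time survives and the other is eliminated; ties are broken by an arbitrary total order of the components with the same birth time. The death time $d_\ell$ is the order of the merging at which the component is eliminated, and $d_\ell=1$ if it is never eliminated. The persistence diagram $PD(T(G))$ is the multiset of the points $(d_\ell,b_\ell)\in\mathbb{R}^2$, over all leaves $\ell$, together with all points of the diagonal $\{(x,x):x\in\mathbb{R}\}$,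 each with countably infinite multiplicity. **Distance.** $d_B(T(G),T(G'))=\inf_\gamma\sup_{A}\|A-\gamma(A)\|_\infty$, where $\gamma$ ranges over the bijections of multisets $PD(T(G))\to PD(T(G'))$, $A$ ranges over $PD(T(G))$, and $\|(v_1,v_2)\|_\infty=\max\{|v_1|,|v_2|\}$. **Star numbers.** $RSN(G',G)$ is the least size of a set of vertices that meets every edge in $E(G)\setminus E(G')$. $ASN(G',G)$ is the least size of a set of vertices that meets every edge in $E(G')\setminus E(G)$. $TSN(G',G)=RSN(G',G)+ASN(G',G)$. **Theorem.** For any two finite graphs $G$ and $G'$, and any choice of the tie-breaking in the two persistence diagrams, $$d_B(T(G),T(G'))\le TSN(G',G).$$ -/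

import Mathlib

open scoped ENNReal

namespace CommunityTree

universe u

/-- A graph whose vertex set `G.verts` and edge set `G.edgeSet` live over a universe `α` of
potential vertices; two graphs over the same `α` may have different vertex sets. -/
abbrev Network (α : Type u) : Type u := (⊤ : SimpleGraph α).Subgraph

variable {α : Type u}

/-- `K` is the vertex set of a `k`-clique of `G`. -/
def IsKClique (G : Network α) (k : ℕ) (K : Finset α) : Prop :=
  (K : Set α) ⊆ G.verts ∧ G.spanningCoe.IsNClique k K

/-- The graph on the `k`-cliques of `G` in which two `k`-cliques are adjacent when they have
exactly `k - 1` vertices in common. -/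
def percolationGraph (G : Network α) (k : ℕ) : SimpleGraph {K : Finset α // IsKClique G k K} where
  Adj K L := ((K.1 : Set α) ∩ (L.1 : Set α)).ncard + 1 = k
  symm := ⟨fun K L h => by rwa [Set.inter_comm]⟩
  loopless := ⟨fun K h => by
    have hk := K.2.2.card_eq
    rw [Set.inter_self, Set.ncard_coe_finset] at h
    omega⟩

/-- The nodes of the community tree of `G`: the unique community of order `1`, which is the whole
graph `G`, and, for every `k ≥ 2`, one community for each connected component of the graph of
`k`-cliques. Nodes of different orders are different even if their subgraphs coincide. -/
inductive Community (G : Network α) : Type u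
  | whole : Community G
  | ofComponent (k : ℕ) (hk : 2 ≤ k) (c : (percolationGraph G k).ConnectedComponent) : Community G

namespace Community

variable {G : Network α}

/-- The order of a community. -/
def order : Community G → ℕ
  | whole => 1
  | ofComponent k _ _ => k

/-- The cliques of size `C.order` that form the community `C`. -/
def cliques : Community G → Set (Finset α)
  | whole => {K | IsKClique G 1 K}
  | ofComponent _ _ c => Subtype.val '' c.supp

/-- The subgraph of `G` that a community spans: `G` itself for order `1`, and the union of the
cliques of the community for order at least `2`. -/
def graph : Community G → Network α
  | whole => G
  | ofComponent k hk c => ⨆ K ∈ (ofComponent k hk c).cliques, (⊤ : Network α).induce (K : Set α)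

/-- The nesting relation of the community tree: `C` lies inside `D`, that is, `D` is the community
of order `D.order ≤ C.order` that contains all cliques of size `D.order` that are contained in
the cliques of `C`. -/
def Nested (C D : Community G) : Prop :=
  D.order ≤ C.order ∧ ∀ K ∈ C.cliques, ∀ L ⊆ K, L.card = D.order → L ∈ D.cliques

end Community

/-- The leaves of the community tree: the communities with no other community inside them. Each
leaf stands for the component of the tree that consists of the communities around this leaf. -/
def Leaf (G : Network α) : Type u := {C : Community G // ∀ D : Community G, D.Nested C → D = C}

/-- The birth time of a component of the tree: the order of its leaf. -/
def birth {G : Network α} (a : Leaf G) : ℕ := a.1.order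

/-- The order at which two components merge: the highest order of a community they share. -/
noncomputable def mergeOrder {G : Network α} (a b : Leaf G) : ℕ :=
  sSup {m | ∃ D : Community G, a.1.Nested D ∧ b.1.Nested D ∧ D.order = m}

/-- `elder a b` ("`a` survives when `a` and `b` merge") is an admissible rule for the merging of
components: a component with a higher birth time survives, and components with the same birth time
are ordered arbitrarily. -/
structure IsElderRule (G : Network α) (elder : Leaf G → Leaf G → Prop) : Prop where
  strictTotal : IsStrictTotalOrder (Leaf G) elder
  of_birth_lt : ∀ a b : Leaf G, birth b < birth a → elder a b

/-- Admissible rules exist: order by birth time and break ties by any strict total order. -/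
theorem exists_isElderRule (G : Network α) : ∃ elder, IsElderRule G elder := by
  classical
  refine ⟨fun a b => birth b < birth a ∨ (birth a = birth b ∧ WellOrderingRel a b), ?_, ?_⟩
  · refine { trichotomous := ?_, irrefl := ?_, trans := ?_ }
    · intro a b h₁ h₂
      rcases lt_trichotomy (birth a) (birth b) with h | h | h
      · exact absurd (Or.inl h) h₂
      · rcases trichotomous_of (WellOrderingRel (α := Leaf G)) a b with h' | h' | h'
        · exact absurd (Or.inr ⟨h, h'⟩) h₁
        · exact h'
        · exact absurd (Or.inr ⟨h.symm, h'⟩) h₂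
      · exact absurd (Or.inl h) h₁
    · rintro a (h | ⟨-, h⟩)
      · exact lt_irrefl _ h
      · exact irrefl _ h
    · rintro a b c (h | ⟨h, h'⟩) (g | ⟨g, g'⟩)
      · exact Or.inl (g.trans h)
      · exact Or.inl (g ▸ h)
      · exact Or.inl (h ▸ g)
      · exact Or.inr ⟨h.trans g, _root_.trans h' g'⟩
  · exact fun a b h => Or.inl h

/-- The death time of a component: the order of its first merging, going down from its leaf to the
root, with a component that survives this merging; it is `1` if there is none. -/
noncomputable def death {G : Network α} (elder : Leaf G → Leaf G → Prop) (a : Leaf G) : ℕ :=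
  sSup ({1} ∪ {m | ∃ b : Leaf G, elder b a ∧ m = mergeOrder a b})

/-- The points `(death, birth)` of the persistence diagram of the community tree of `G`, as a
family indexed by the components, so that points are counted with multiplicity. -/
noncomputable def diagramPoint (G : Network α) (elder : Leaf G → Leaf G → Prop) (a : Leaf G) :
    ℝ × ℝ :=
  ((death elder a : ℝ), (birth a : ℝ))

/-- The persistence diagram with points `p i`: the diagonal is added to it, each of its points
with countably infinite multiplicity. -/
def withDiagonal {ι : Type u} (p : ι → ℝ × ℝ) : ι ⊕ (ℝ × ℕ) → ℝ × ℝ :=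
  Sum.elim p (fun x => (x.1, x.1))

/-- The bottleneck distance of the persistence diagrams with points `p i` and `q j`. The distance
of `ℝ × ℝ` is that of the maximum norm. -/
noncomputable def bottleneckDist {ι κ : Type u} (p : ι → ℝ × ℝ) (q : κ → ℝ × ℝ) : ℝ≥0∞ :=
  ⨅ γ : (ι ⊕ (ℝ × ℕ)) ≃ (κ ⊕ (ℝ × ℕ)), ⨆ x, edist (withDiagonal p x) (withDiagonal q (γ x))

/-- The removal star number of `G'` and `G`: the least number of vertices that meet every edge of
`G` that is not an edge of `G'`. -/
noncomputable def RSN (G' G : Network α) : ℕ :=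
  sInf {n | ∃ V₀ : Finset α, V₀.card = n ∧ ∀ e ∈ G.edgeSet \ G'.edgeSet, ∃ v ∈ V₀, v ∈ e}

/-- The addition star number of `G'` and `G`: the least number of vertices that meet every edge of
`G'` that is not an edge of `G`. -/
noncomputable def ASN (G' G : Network α) : ℕ :=
  sInf {n | ∃ V₀ : Finset α, V₀.card = n ∧ ∀ e ∈ G'.edgeSet \ G.edgeSet, ∃ v ∈ V₀, v ∈ e}

/-- The total star number of `G'` and `G`. -/
noncomputable def TSN (G' G : Network α) : ℕ := RSN G' G + ASN G' G

end CommunityTree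

/-! ### Abstract merge trees and the elder rule -/

namespace CommunityTree

/-! Let U be the union of a least set of vertices meeting E(G) \ E(G') and a least set meeting E(G')
\ E(G). It has at most n = TSN vertices, and off U the two graphs have the same edges. Deleting U
from an m-clique of G leaves a clique of G' with at least m - n vertices, and adjacent m-cliques
leave cliques linked at order m - n if this is at least 2 (`linked_sdiff_of_adj`). At order 1 there
is only one community, so nothing is lost. Hence the two community trees are n-interleaved
(`exists_interleaved`).

The rest is stability of merge trees, by a combinatorial induced matching. Keeping the births of A
but pulling the merging times of B back along f gives `imageDeath`, the deaths in the image of A in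
B. From A to the image, births stay and the deaths of components with `imageDeath + n < birth` move
by at most n. From the image to B, deaths stay and births move by at most n. For the latter,
consider a merging at order d: a branch whose oldest components die at d in both the image and B is
matched with itself; if the image and B disagree about the surviving branch, the two survivors are
swapped (`Matched`). Unmatched components live for at most 2n, so their points lie within n of the
diagonal, where `bottleneckDist_le_of_matching` disposes of them. -/

/-- Birth times and merging times of the components of an abstract merge tree. -/
structure IsMergeTree {A : Type*} (birth : A → ℕ) (merge : A → A → ℕ) : Prop where
  self : ∀ a, merge a a = birth a
  symm : ∀ a b, merge a b = merge b a
  ultra : ∀ a b c, min (merge a b) (merge b c) ≤ merge a c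
  pos : ∀ a b, 1 ≤ merge a b

/-- A rule which decides, compatibly with the birth times, which component survives. -/
structure IsElder {A : Type*} (birth : A → ℕ) (elder : A → A → Prop) : Prop where
  strictTotal : IsStrictTotalOrder A elder
  of_birth_lt : ∀ a b, birth b < birth a → elder a b

/-- The death times determined by merging times and an elder rule. -/
noncomputable def elderDeath {A : Type*} (merge : A → A → ℕ) (elder : A → A → Prop) (a : A) : ℕ :=
  sSup ({1} ∪ {m | ∃ b, elder b a ∧ m = merge a b})

namespace IsMergeTree

variable {A : Type*} {birth : A → ℕ} {merge : A → A → ℕ}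

theorem le_trans (h : IsMergeTree birth merge) {k : ℕ} {a b c : A} (hab : k ≤ merge a b)
    (hbc : k ≤ merge b c) : k ≤ merge a c :=
  (le_min hab hbc).trans (h.ultra a b c)

theorem le_symm (h : IsMergeTree birth merge) {k : ℕ} {a b : A} (hab : k ≤ merge a b) :
    k ≤ merge b a :=
  h.symm a b ▸ hab

theorem le_birth_left (h : IsMergeTree birth merge) {k : ℕ} {a b : A} (hab : k ≤ merge a b) :
    k ≤ birth a :=
  h.self a ▸ h.le_trans hab (h.le_symm hab)

theorem one_le_birth (h : IsMergeTree birth merge) (a : A) : 1 ≤ birth a :=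
  h.self a ▸ h.pos a a

end IsMergeTree

section Death

variable {A : Type*} {merge : A → A → ℕ} {elder : A → A → Prop}

theorem elderDeath_set_bddAbove [Finite A] (a : A) :
    BddAbove ({1} ∪ {m | ∃ b, elder b a ∧ m = merge a b}) := by
  refine ((Set.finite_singleton 1).union ((Set.finite_range (merge a)).subset ?_)).bddAbove
  rintro m ⟨b, -, rfl⟩
  exact ⟨b, rfl⟩

theorem one_le_elderDeath [Finite A] (a : A) : 1 ≤ elderDeath merge elder a :=
  le_csSup (elderDeath_set_bddAbove a) (Or.inl rfl)

theorem merge_le_elderDeath [Finite A] {a b : A} (h : elder b a) : merge a b ≤ elderDeath merge elder a :=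
  le_csSup (elderDeath_set_bddAbove a) (Or.inr ⟨b, h, rfl⟩)

theorem elderDeath_le {a : A} {k : ℕ} (hk : 1 ≤ k) (h : ∀ b, elder b a → merge a b ≤ k) :
    elderDeath merge elder a ≤ k := by
  refine csSup_le ⟨1, Or.inl rfl⟩ ?_
  rintro m (rfl | ⟨b, hb, rfl⟩)
  · exact hk
  · exact h b hb

theorem elderDeath_le_birth {birth : A → ℕ} (h : IsMergeTree birth merge) (a : A) :
    elderDeath merge elder a ≤ birth a :=
  elderDeath_le (h.one_le_birth a) fun _ _ => h.le_birth_left le_rfl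

end Death

section Top

variable {A B : Type*} {birth : A → ℕ} {elder : A → A → Prop}
  {birthB : B → ℕ} {merge : B → B → ℕ}

theorem IsElder.birth_le (he : IsElder birth elder) {a b : A} (h : elder a b) :
    birth b ≤ birth a := by
  have := he.strictTotal
  by_contra! hlt
  exact irrefl_of elder a (trans_of elder h (he.of_birth_lt _ _ hlt))

/-- In each class of components at a given order there is a component that is alive there. -/
theorem exists_top [Finite A] (he : IsElder birth elder) (hm : IsMergeTree birthB merge) (f : A → B) {k : ℕ}
    (hk : 2 ≤ k) {x : B} {a₀ : A} (h : k ≤ merge (f a₀) x) :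
    ∃ a, k ≤ merge (f a) x ∧ elderDeath (fun a a' => merge (f a) (f a')) elder a < k ∧
      birth a₀ ≤ birth a := by
  have := he.strictTotal
  -- On a finite type the eldest member of the class exists as a minimal element of `elder`; nothing
  -- elder to it reaches it at order `k`.
  have wf : WellFounded elder := Finite.wellFounded_of_trans_of_irrefl elder
  obtain ⟨a, ha, hmin⟩ := wf.has_min {a | k ≤ merge (f a) x} ⟨a₀, h⟩
  refine ⟨a, ha, ?_, ?_⟩
  · have : elderDeath (fun a a' => merge (f a) (f a')) elder a ≤ k - 1 := by
      refine elderDeath_le (by omega) fun b hb => ?_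
      by_contra! hlt
      exact hmin b (hm.le_trans (hm.le_symm (show k ≤ merge (f a) (f b) by omega)) ha) hb
    omega
  · by_contra! hlt
    exact hmin a₀ h (he.of_birth_lt _ _ hlt)

/-- Two components that are alive at an order at which they have merged coincide. -/
theorem top_unique [Finite A] (he : IsElder birth elder) (hm : IsMergeTree birthB merge) (f : A → B) {k : ℕ}
    {a a' : A} (h : k ≤ merge (f a) (f a'))
    (ha : elderDeath (fun a a' => merge (f a) (f a')) elder a < k)
    (ha' : elderDeath (fun a a' => merge (f a) (f a')) elder a' < k) : a = a' := by
  have := he.strictTotal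
  rcases trichotomous_of elder a a' with hlt | heq | hlt
  · have := merge_le_elderDeath (merge := fun a a' => merge (f a) (f a')) hlt
    have := hm.le_symm h
    omega
  · exact heq
  · have := merge_le_elderDeath (merge := fun a a' => merge (f a) (f a')) hlt
    omega

end Top

/-! ### Interleavings and the induced matching -/

/-- Two abstract merge trees are interleaved with shift `n`. -/
structure Interleaved {A B : Type*} (n : ℕ) (bA : A → ℕ) (mA : A → A → ℕ) (bB : B → ℕ)
    (mB : B → B → ℕ) (f : A → B) (g : B → A) : Prop where
  birth_right : ∀ a, bA a ≤ bB (f a) + n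
  birth_left : ∀ b, bB b ≤ bA (g b) + n
  merge_right : ∀ a a', mA a a' ≤ mB (f a) (f a') + n
  merge_left : ∀ b b', mB b b' ≤ mA (g b) (g b') + n
  unit_left : ∀ a, bA a ≤ mA a (g (f a)) + 2 * n
  unit_right : ∀ b, bB b ≤ mB b (f (g b)) + 2 * n

section Matching

variable {A B : Type*} {bA : A → ℕ} {mA : A → A → ℕ} {bB : B → ℕ} {mB : B → B → ℕ}
  {elderA : A → A → Prop} {elderB : B → B → Prop} {f : A → B} {g : B → A} {n : ℕ}

/-- The death times, with respect to the merging times of the images under `f`. -/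
noncomputable def imageDeath (mB : B → B → ℕ) (elderA : A → A → Prop) (f : A → B) (a : A) : ℕ :=
  elderDeath (fun a a' => mB (f a) (f a')) elderA a

/-- The matching of the components of interleaved merge trees. A component `a` is matched with the
component `b` that lives in the branch of `f a` and dies there at the same order; if the branch of
`f a` survives, then `b` lives instead in the branch of the component `a'` that eliminates `a`. -/
def Matched (n : ℕ) (bA : A → ℕ) (mB : B → B → ℕ) (elderA : A → A → Prop) (elderB : B → B → Prop)
    (f : A → B) (a : A) (b : B) : Prop :=
  imageDeath mB elderA f a = elderDeath mB elderB b ∧ elderDeath mB elderB b + n < bA a ∧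
    (elderDeath mB elderB b + 1 ≤ mB b (f a) ∨
      ∃ a' c, elderDeath mB elderB c < elderDeath mB elderB b ∧
        elderDeath mB elderB b + 1 ≤ mB c (f a) ∧
        imageDeath mB elderA f a' < elderDeath mB elderB b ∧
        elderDeath mB elderB b ≤ mB (f a') (f a) ∧
        elderDeath mB elderB b + 1 ≤ mB b (f a'))

/-- By `top_unique`, each class at a given order has one survivor. The two clauses of `Matched`
exclude each other: the branch of `f a` cannot have both a top dying at that order and a top `c`
outliving it. In the second clause `a'` is determined by the class of `f a`, and then `b` by `a'`.
-/
theorem Matched.right_unique [Finite A] [Finite B] (hB : IsMergeTree bB mB)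
    (heA : IsElder bA elderA) (heB : IsElder bB elderB) {a : A} {b₁ b₂ : B}
    (h₁ : Matched n bA mB elderA elderB f a b₁) (h₂ : Matched n bA mB elderA elderB f a b₂) :
    b₁ = b₂ := by
  have uB : ∀ {k b b'}, k ≤ mB b b' → elderDeath mB elderB b < k → elderDeath mB elderB b' < k →
    b = b' := fun h h' h'' => top_unique heB hB id h h' h''
  have uA : ∀ {k a a'}, k ≤ mB (f a) (f a') → imageDeath mB elderA f a < k →
    imageDeath mB elderA f a' < k → a = a' := fun h h' h'' => top_unique heA hB f h h' h''
  obtain ⟨d₁, l₁, c₁⟩ := h₁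
  obtain ⟨d₂, l₂, c₂⟩ := h₂
  have hd : elderDeath mB elderB b₁ = elderDeath mB elderB b₂ := d₁.symm.trans d₂
  rw [← hd] at d₂ l₂ c₂
  rcases c₁ with c₁ | ⟨a₁, x₁, p₁, q₁, r₁, s₁, t₁⟩ <;>
    rcases c₂ with c₂ | ⟨a₂, x₂, p₂, q₂, r₂, s₂, t₂⟩
  · exact uB (hB.le_trans c₁ (hB.le_symm c₂)) (by omega) (by omega)
  · have := uB (hB.le_trans c₁ (hB.le_symm q₂)) (by omega) (by omega)
    subst this
    omega
  · have := uB (hB.le_trans c₂ (hB.le_symm q₁)) (by omega) (by omega)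
    subst this
    omega
  · have := uA (hB.le_trans s₁ (hB.le_symm s₂)) r₁ r₂
    subst this
    exact uB (hB.le_trans t₁ (hB.le_symm t₂)) (by omega) (by omega)

/-- The swap is read backwards: `b` determines `a'` as the survivor in its branch, the class
determines its survivor `c` in B, and the branch of `c` determines `a`. -/
theorem Matched.left_unique [Finite A] [Finite B] (hB : IsMergeTree bB mB)
    (heA : IsElder bA elderA) (heB : IsElder bB elderB) {a₁ a₂ : A} {b : B}
    (h₁ : Matched n bA mB elderA elderB f a₁ b) (h₂ : Matched n bA mB elderA elderB f a₂ b) :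
    a₁ = a₂ := by
  have uB : ∀ {k b b'}, k ≤ mB b b' → elderDeath mB elderB b < k → elderDeath mB elderB b' < k →
    b = b' := fun h h' h'' => top_unique heB hB id h h' h''
  have uA : ∀ {k a a'}, k ≤ mB (f a) (f a') → imageDeath mB elderA f a < k →
    imageDeath mB elderA f a' < k → a = a' := fun h h' h'' => top_unique heA hB f h h' h''
  obtain ⟨d₁, l₁, c₁⟩ := h₁
  obtain ⟨d₂, l₂, c₂⟩ := h₂
  rcases c₁ with c₁ | ⟨a₁', x₁, p₁, q₁, r₁, s₁, t₁⟩ <;>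
    rcases c₂ with c₂ | ⟨a₂', x₂, p₂, q₂, r₂, s₂, t₂⟩
  · exact uA (hB.le_trans (hB.le_symm c₁) c₂) (by omega) (by omega)
  · have := uA (hB.le_trans (hB.le_symm c₁) t₂) (by omega) (by omega)
    subst this
    omega
  · have := uA (hB.le_trans (hB.le_symm c₂) t₁) (by omega) (by omega)
    subst this
    omega
  · have := uA ((Nat.le_succ _).trans (hB.le_trans (hB.le_symm t₁) t₂)) r₁ r₂
    subst this
    have e₁ := hB.le_trans ((Nat.le_succ _).trans q₁) (hB.le_symm s₁)
    have e₂ := hB.le_trans ((Nat.le_succ _).trans q₂) (hB.le_symm s₂)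
    have := uB (hB.le_trans e₁ (hB.le_symm e₂)) p₁ p₂
    subst this
    exact uA (hB.le_trans (hB.le_symm q₁) q₂) (by omega) (by omega)

/-- The branch in which a component of the image dies contains no component with a much higher
birth time. -/
theorem Interleaved.birth_le_of_merge [Finite A] (hI : Interleaved n bA mA bB mB f g)
    (hB : IsMergeTree bB mB) (heA : IsElder bA elderA) {a : A} {c : B}
    (ha : imageDeath mB elderA f a + n < bA a) (hc : imageDeath mB elderA f a + 1 ≤ mB c (f a)) :
    bB c ≤ bA a + n := by
  by_contra! hlt
  have h₁ := hI.birth_left c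
  have h₂ := hI.unit_right c
  have h₃ : imageDeath mB elderA f a + 1 ≤ mB (f a) (f (g c)) :=
    hB.le_trans (hB.le_symm hc) (by omega)
  have h₄ := merge_le_elderDeath (merge := fun a a' => mB (f a) (f a'))
    (heA.of_birth_lt (g c) a (by omega))
  have : elderDeath (fun a a' => mB (f a) (f a')) elderA a = imageDeath mB elderA f a := rfl
  omega

theorem Interleaved.exists_matched_right [Finite A] [Finite B]
    (hI : Interleaved n bA mA bB mB f g)
    (hB : IsMergeTree bB mB) (heA : IsElder bA elderA) (heB : IsElder bB elderB) {a : A}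
    (ha : imageDeath mB elderA f a + n < bA a) :
    ∃ b, Matched n bA mB elderA elderB f a b ∧ bB b ≤ bA a + n ∧ bA a ≤ bB b + n := by
  have eB : ∀ {k x}, 2 ≤ k → k ≤ bB x → ∃ b, k ≤ mB b x ∧ elderDeath mB elderB b < k ∧
    bB x ≤ bB b := fun hk hx => exists_top heB hB id hk (le_of_le_of_eq hx (hB.self _).symm)
  have hf := hI.birth_right a
  have hpos : 1 ≤ imageDeath mB elderA f a := one_le_elderDeath a
  obtain ⟨c, hc, hdc, hbc⟩ := eB (k := imageDeath mB elderA f a + 1) (x := f a) (by omega)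
    (by omega)
  have hcup := hI.birth_le_of_merge hB heA ha hc
  -- With d the image death of `a`, the top `c` of the branch of `f a` at order d + 1 either dies at
  -- d and is the match, or outlives d and forces the swap.
  rcases Nat.lt_succ_iff_lt_or_eq.1 hdc with hlt | heq
  · have hpos' : 1 ≤ elderDeath mB elderB c := one_le_elderDeath c
    obtain ⟨a', ha', hda', hba'⟩ := exists_top heA hB f (k := imageDeath mB elderA f a)
      (x := f a) (a₀ := a) (by omega) (by rw [hB.self]; omega)
    change imageDeath mB elderA f a' < _ at hda'
    have hf' := hI.birth_right a'
    obtain ⟨b, hb, hdb, hbb⟩ := eB (k := imageDeath mB elderA f a + 1) (x := f a') (by omega)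
      (by omega)
    have hmax : ¬ imageDeath mB elderA f a + 1 ≤ mB (f a') (f a) := fun h => by
      have := top_unique heA hB f h (hda'.trans (Nat.lt_succ_self _)) (Nat.lt_succ_self _)
      subst this
      exact lt_irrefl _ hda'
    have hcb : imageDeath mB elderA f a ≤ mB c b :=
      hB.le_trans ((Nat.le_succ _).trans hc)
        (hB.le_trans (hB.le_symm ha') (hB.le_symm ((Nat.le_succ _).trans hb)))
    -- Otherwise `b` and `c` both survive in one class at order d, hence coincide, and `a'` would
    -- lie in the branch of `f a`.
    have hd : elderDeath mB elderB b = imageDeath mB elderA f a := by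
      by_contra hne
      have := top_unique heB hB id hcb hlt (lt_of_le_of_ne (Nat.lt_succ_iff.1 hdb) hne)
      subst this
      exact hmax (hB.le_trans (hB.le_symm hb) hc)
    have helder : elderB c b := by
      have := heB.strictTotal
      rcases trichotomous_of elderB c b with h | h | h
      · exact h
      · subst h; omega
      · have := merge_le_elderDeath (merge := mB) h
        omega
    -- Births compare along `b` ≤ `c` ≤ `a` + n and `a` ≤ `a'` ≤ `f a'` + n ≤ `b` + n.
    have := heB.birth_le helder
    refine ⟨b, ⟨hd.symm, by omega, Or.inr ⟨a', c, ?_⟩⟩, by omega, by omega⟩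
    rw [hd]
    exact ⟨hlt, hc, hda', ha', hb⟩
  · refine ⟨c, ⟨heq.symm, by omega, Or.inl ?_⟩, hcup, by omega⟩
    rw [heq]
    exact hc

theorem Interleaved.exists_matched_left [Finite A] [Finite B]
    (hI : Interleaved n bA mA bB mB f g)
    (hB : IsMergeTree bB mB) (heA : IsElder bA elderA) (heB : IsElder bB elderB) {b : B}
    (hb : elderDeath mB elderB b + 2 * n < bB b) : ∃ a, Matched n bA mB elderA elderB f a b := by
  -- The round trip `f (g x)` stays in the branch of `x` down from order `bB x - 2 * n`, so the
  -- image reaches this branch; hence the lifetime bound 2n.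
  have eA : ∀ {k x}, 2 ≤ k → k + 2 * n ≤ bB x → ∃ a, k ≤ mB (f a) x ∧
      imageDeath mB elderA f a < k ∧ bB x ≤ bA a + n := fun {k x} hk hx => by
    have h₁ := hI.birth_left x
    have h₂ := hI.unit_right x
    obtain ⟨a, h, h', h''⟩ := exists_top heA hB f (k := k) (x := x) (a₀ := g x) hk
      (hB.le_symm (by omega))
    exact ⟨a, h, h', by omega⟩
  have hpos : 1 ≤ elderDeath mB elderB b := one_le_elderDeath b
  obtain ⟨a, ha, hda, hba⟩ := eA (k := elderDeath mB elderB b + 1) (x := b) (by omega) (by omega)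
  rcases Nat.lt_succ_iff_lt_or_eq.1 hda with hlt | heq
  · have hpos' : 1 ≤ imageDeath mB elderA f a := one_le_elderDeath a
    obtain ⟨c, hc, hdc, hbc⟩ := exists_top heB hB id (k := elderDeath mB elderB b) (x := b)
      (a₀ := b) (by omega) (by change _ ≤ mB b b; rw [hB.self]; omega)
    change elderDeath mB elderB c < _ at hdc
    change _ ≤ mB c b at hc
    obtain ⟨a₂, ha₂, hda₂, hba₂⟩ := eA (k := elderDeath mB elderB b + 1) (x := c) (by omega)
      (by omega)
    have haa : elderDeath mB elderB b ≤ mB (f a) (f a₂) :=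
      hB.le_trans ((Nat.le_succ _).trans ha)
        (hB.le_trans (hB.le_symm hc) (hB.le_symm ((Nat.le_succ _).trans ha₂)))
    have hd : imageDeath mB elderA f a₂ = elderDeath mB elderB b := by
      by_contra hne
      have := top_unique heA hB f haa hlt (lt_of_le_of_ne (Nat.lt_succ_iff.1 hda₂) hne)
      subst this
      have := top_unique heB hB id (hB.le_trans (hB.le_symm ha₂) ha)
        (hdc.trans (Nat.lt_succ_self _)) (Nat.lt_succ_self _)
      subst this
      exact lt_irrefl _ hdc
    exact ⟨a₂, hd, by omega, Or.inr ⟨a, c, hdc, hB.le_symm ha₂, hlt, haa, hB.le_symm ha⟩⟩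
  · exact ⟨a, heq, by omega, Or.inl (hB.le_symm ha)⟩

/-- Follow `a`, `g (f a)`, `g (f a')`, `a'`: the outer steps cost 2n from the births, the middle one
costs n from the merging time in B. -/
theorem Interleaved.merge_le (hI : Interleaved n bA mA bB mB f g)
    (hA : IsMergeTree bA mA) {a a' : A} (h : bA a ≤ bA a') :
    min (bA a) (mB (f a) (f a') + n) ≤ mA a a' + 2 * n := by
  have h₁ := hI.unit_left a
  have h₂ := hI.unit_left a'
  have h₃ := hI.merge_left (f a) (f a')
  have := hA.le_trans (k := min (bA a) (mB (f a) (f a') + n) - 2 * n)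
    (show _ ≤ mA a (g (f a)) by omega)
    (hA.le_trans (show _ ≤ mA (g (f a)) (g (f a')) by omega)
      (hA.le_symm (show _ ≤ mA a' (g (f a')) by omega)))
  omega

theorem Interleaved.elderDeath_le_imageDeath [Finite A] (hI : Interleaved n bA mA bB mB f g)
    (a : A) : elderDeath mA elderA a ≤ imageDeath mB elderA f a + n := by
  refine elderDeath_le ?_ fun a' h => ?_
  · exact (one_le_elderDeath a).trans (Nat.le_add_right _ _)
  · exact (hI.merge_right a a').trans (Nat.add_le_add_right
      (merge_le_elderDeath (merge := fun a a' => mB (f a) (f a')) h) n)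

theorem Interleaved.imageDeath_le_elderDeath [Finite A] (hI : Interleaved n bA mA bB mB f g)
    (hA : IsMergeTree bA mA) (heA : IsElder bA elderA) (a : A) :
    min (bA a) (imageDeath mB elderA f a + n) ≤ elderDeath mA elderA a + 2 * n := by
  have h1 : 1 ≤ elderDeath mA elderA a := one_le_elderDeath a
  by_contra! hlt
  have : imageDeath mB elderA f a ≤ elderDeath mA elderA a + n := by
    refine elderDeath_le (by omega) fun a' h => ?_
    have h₁ := hI.merge_le hA (heA.birth_le h)
    have h₂ := merge_le_elderDeath (merge := mA) h
    omega
  omega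

/-- Interleaved merge trees have matched components: matched components have close birth and death
times, and only short-lived components are not matched. -/
theorem Interleaved.exists_matching [Finite A] [Finite B] (hI : Interleaved n bA mA bB mB f g)
    (hA : IsMergeTree bA mA) (hB : IsMergeTree bB mB) (heA : IsElder bA elderA)
    (heB : IsElder bB elderB) :
    ∃ R : A → B → Prop, (∀ a b b', R a b → R a b' → b = b') ∧ (∀ a a' b, R a b → R a' b → a = a') ∧
      (∀ a b, R a b → bA a ≤ bB b + n ∧ bB b ≤ bA a + n ∧
        elderDeath mA elderA a ≤ elderDeath mB elderB b + n ∧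
        elderDeath mB elderB b ≤ elderDeath mA elderA a + n) ∧
      (∀ a, (∀ b, ¬ R a b) → bA a ≤ elderDeath mA elderA a + 2 * n) ∧
      (∀ b, (∀ a, ¬ R a b) → bB b ≤ elderDeath mB elderB b + 2 * n) := by
  refine ⟨Matched n bA mB elderA elderB f, fun a b b' => Matched.right_unique hB heA heB,
    fun a a' b => Matched.left_unique hB heA heB, fun a b h => ?_, fun a h => ?_, fun b h => ?_⟩
  · have h₁ := hI.elderDeath_le_imageDeath (elderA := elderA) a
    have h₂ := hI.imageDeath_le_elderDeath hA heA a
    have h₃ := h.1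
    have h₄ := h.2.1
    obtain ⟨b', hb', hle, hle'⟩ := hI.exists_matched_right hB heA heB (a := a) (by omega)
    have := Matched.right_unique hB heA heB h hb'
    subst this
    omega
  · have h₂ := hI.imageDeath_le_elderDeath hA heA a
    by_contra! hlt
    obtain ⟨b, hb, -⟩ := hI.exists_matched_right hB heA heB (a := a) (by omega)
    exact h b hb
  · by_contra! hlt
    obtain ⟨a, ha⟩ := hI.exists_matched_left hB heA heB hlt
    exact h a ha

end Matching

-- From a matching to the bottleneck distance

universe u

/-- A matching of close points which leaves only points near the diagonal unmatched bounds the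
bottleneck distance. The remaining points and the diagonal are matched along the fibres of the
midpoint map `(d, b) ↦ (d + b) / 2`, which are all countably infinite. -/
theorem bottleneckDist_le_of_matching {ι κ : Type u} [Finite ι] [Finite κ] (p : ι → ℝ × ℝ)
    (q : κ → ℝ × ℝ) (n : ℕ) (R : ι → κ → Prop) (hr : ∀ a b b', R a b → R a b' → b = b')
    (hl : ∀ a a' b, R a b → R a' b → a = a') (hR : ∀ a b, R a b → dist (p a) (q b) ≤ n)
    (hp : ∀ a, (∀ b, ¬ R a b) → (p a).1 ≤ (p a).2 ∧ (p a).2 ≤ (p a).1 + 2 * n)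
    (hq : ∀ b, (∀ a, ¬ R a b) → (q b).1 ≤ (q b).2 ∧ (q b).2 ≤ (q b).1 + 2 * n) :
    bottleneckDist p q ≤ n := by
  classical
  let M : ι → Prop := fun a => ∃ b, R a b
  let N : κ → Prop := fun b => ∃ a, R a b
  let mid : ℝ × ℝ → ℝ := fun x => (x.1 + x.2) / 2
  have e₁ : ∃ e : {a // M a} ≃ {b // N b}, ∀ a, R a.1 (e a).1 := by
    choose F hF using fun a : {a // M a} => a.2
    refine ⟨Equiv.ofBijective (fun a => ⟨F a, a.1, hF a⟩) ⟨fun a a' h => ?_, fun b => ?_⟩, hF⟩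
    · have h' : F a = F a' := congrArg Subtype.val h
      exact Subtype.ext (hl _ _ _ (hF a) (h' ▸ hF a'))
    · obtain ⟨b, a, hab⟩ := b
      exact ⟨⟨a, b, hab⟩, Subtype.ext (hr _ _ _ (hF _) hab)⟩
  obtain ⟨e, he⟩ := e₁
  let P : {a // ¬ M a} ⊕ (ℝ × ℕ) → ℝ × ℝ := Sum.elim (fun a => p a.1) fun x => (x.1, x.1)
  let Q : {b // ¬ N b} ⊕ (ℝ × ℕ) → ℝ × ℝ := Sum.elim (fun b => q b.1) fun x => (x.1, x.1)
  have hP : ∀ x, (P x).1 ≤ (P x).2 ∧ (P x).2 ≤ (P x).1 + 2 * n := by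
    rintro (⟨a, ha⟩ | x)
    · exact hp a fun b hb => ha ⟨b, hb⟩
    · simp [P]
  have hQ : ∀ x, (Q x).1 ≤ (Q x).2 ∧ (Q x).2 ≤ (Q x).1 + 2 * n := by
    rintro (⟨b, hb⟩ | x)
    · exact hq b fun a ha => hb ⟨a, ha⟩
    · simp [Q]
  -- In a fibre the diagonal point is fixed, so only its copy index in `ℕ` varies, besides finitely
  -- many other points.
  have fib : ∀ {τ : Type u} [Finite τ] (T : τ ⊕ (ℝ × ℕ) → ℝ × ℝ),
      (∀ x : ℝ × ℕ, T (Sum.inr x) = (x.1, x.1)) → ∀ m : ℝ,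
      Countable {x // mid (T x) = m} ∧ Infinite {x // mid (T x) = m} := by
    intro τ _ T hT m
    constructor
    · refine Function.Injective.countable (β := τ ⊕ ℕ)
        (f := fun x => Sum.map id Prod.snd x.1) ?_
      rintro ⟨x | x, hx⟩ ⟨y | y, hy⟩ hxy
      · simpa using hxy
      · simp at hxy
      · simp at hxy
      · have h₂ : x.2 = y.2 := by simpa using hxy
        have h₁ : x.1 = y.1 := by
          simp only [hT, mid] at hx hy
          linarith
        simp [Prod.ext h₁ h₂]
    · refine Infinite.of_injective (fun k : ℕ => ⟨Sum.inr (m, k), ?_⟩) ?_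
      · simp only [hT, mid]
        ring
      · intro k k' h
        simpa using h
  have fe : ∀ m : ℝ, Nonempty ({x // mid (P x) = m} ≃ {x // mid (Q x) = m}) := by
    intro m
    obtain ⟨_, _⟩ := fib P (fun _ => rfl) m
    obtain ⟨_, _⟩ := fib Q (fun _ => rfl) m
    exact nonempty_equiv_of_countable
  let E := fun m => (fe m).some
  let D : {a // ¬ M a} ⊕ (ℝ × ℕ) ≃ {b // ¬ N b} ⊕ (ℝ × ℕ) :=
    (Equiv.sigmaFiberEquiv fun x => mid (P x)).symm.trans
      ((Equiv.sigmaCongrRight E).trans (Equiv.sigmaFiberEquiv fun x => mid (Q x)))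
  have hD : ∀ x, mid (Q (D x)) = mid (P x) := fun x => (E (mid (P x)) ⟨x, rfl⟩).2
  -- With common midpoint m, both first coordinates lie in [m - n, m] and both second ones in [m, m
  -- + n].
  have hdist : ∀ x, dist (P x) (Q (D x)) ≤ n := by
    intro x
    have h₁ := hP x
    have h₂ := hQ (D x)
    have h₃ := hD x
    simp only [mid] at h₃
    rw [Prod.dist_eq, Real.dist_eq, Real.dist_eq]
    refine max_le (abs_le.2 ⟨?_, ?_⟩) (abs_le.2 ⟨?_, ?_⟩) <;> linarith [h₁.1, h₁.2, h₂.1, h₂.2]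
  let Γ : ι ⊕ (ℝ × ℕ) ≃ κ ⊕ (ℝ × ℕ) :=
    ((Equiv.sumCongr (Equiv.sumCompl M).symm (Equiv.refl _)).trans (Equiv.sumAssoc _ _ _)).trans
      ((Equiv.sumCongr e D).trans
        ((Equiv.sumAssoc _ _ _).symm.trans (Equiv.sumCongr (Equiv.sumCompl N) (Equiv.refl _))))
  have hQ' : ∀ y, withDiagonal q (Sum.map (Equiv.sumCompl N) id
      ((Equiv.sumAssoc {b // N b} {b // ¬ N b} (ℝ × ℕ)).symm (Sum.inr y))) = Q y := by
    rintro (y | y) <;> rfl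
  have hΓ : ∀ x, dist (withDiagonal p x) (withDiagonal q (Γ x)) ≤ n := by
    rintro (a | x)
    · by_cases ha : M a
      · have : Γ (Sum.inl a) = Sum.inl (e ⟨a, ha⟩).1 := by
          simp [Γ, Equiv.sumCompl_symm_apply_of_pos ha]
        rw [this]
        exact hR _ _ (he ⟨a, ha⟩)
      · have : withDiagonal q (Γ (Sum.inl a)) = Q (D (Sum.inl ⟨a, ha⟩)) := by
          rw [← hQ']
          simp [Γ, Equiv.sumCompl_symm_apply_of_neg ha]
        rw [this]
        exact hdist (Sum.inl ⟨a, ha⟩)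
    · have : withDiagonal q (Γ (Sum.inr x)) = Q (D (Sum.inr x)) := by
        rw [← hQ']
        simp [Γ]
      rw [this]
      exact hdist (Sum.inr x)
  refine (iInf_le _ Γ).trans (iSup_le fun x => ?_)
  rw [edist_dist, ← ENNReal.ofReal_natCast]
  exact ENNReal.ofReal_le_ofReal (hΓ x)

/-! ### Clique percolation under deletion of vertices -/

section Linked

variable {α : Type u} {G G' : Network α}

/-- Two vertices are needed: a single point outside `G.verts` is a clique of `G.spanningCoe`, but an
endpoint of an edge is in `G.verts`. -/
theorem isKClique_of_subset {m : ℕ} (hm : 2 ≤ m) {K S : Finset α} (hK : G.spanningCoe.IsClique K)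
    (hS : S ⊆ K) (hc : S.card = m) : IsKClique G m S := by
  have hcl : G.spanningCoe.IsClique S := hK.subset (Finset.coe_subset.2 hS)
  refine ⟨fun v hv => ?_, hcl, hc⟩
  obtain ⟨u, hu, hne⟩ := Finset.exists_mem_ne (by omega : 1 < S.card) v
  exact G.edge_vert (hcl hv hu hne.symm)

theorem percolationGraph_adj [DecidableEq α] {m : ℕ} {S T : {K : Finset α // IsKClique G m K}} :
    (percolationGraph G m).Adj S T ↔ (S.1 ∩ T.1).card + 1 = m := by
  change ((S.1 : Set α) ∩ (T.1 : Set α)).ncard + 1 = m ↔ _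
  rw [← Finset.coe_inter, Set.ncard_coe_finset]

/-- Exchange one vertex of `S \ T` for one of `T \ S` at a time; every intermediate set stays in the
clique `K`. -/
theorem reachable_of_subset_isClique {m : ℕ} (hm : 2 ≤ m) {K : Finset α}
    (hK : G.spanningCoe.IsClique K) (S T : {K : Finset α // IsKClique G m K}) (hS : S.1 ⊆ K)
    (hT : T.1 ⊆ K) : (percolationGraph G m).Reachable S T := by
  classical
  induction hn : (S.1 \ T.1).card generalizing S with
  | zero =>
    have hsub : S.1 ⊆ T.1 := by simpa using hn
    have := Finset.eq_of_subset_of_card_le hsub (by rw [S.2.2.card_eq, T.2.2.card_eq])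
    rw [Subtype.ext this]
  | succ n ih =>
    have hcard : (S.1 \ T.1).card = (T.1 \ S.1).card :=
      Finset.card_sdiff_comm (by rw [S.2.2.card_eq, T.2.2.card_eq])
    obtain ⟨x, hx⟩ := Finset.card_pos.1 (by omega : 0 < (S.1 \ T.1).card)
    obtain ⟨y, hy⟩ := Finset.card_pos.1 (by omega : 0 < (T.1 \ S.1).card)
    rw [Finset.mem_sdiff] at hx hy
    have hSc := S.2.2.card_eq
    have hsub : insert y (S.1.erase x) ⊆ K :=
      Finset.insert_subset (hT hy.1) ((Finset.erase_subset _ _).trans hS)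
    have hc : (insert y (S.1.erase x)).card = m := by
      rw [Finset.card_insert_of_notMem (fun h => hy.2 (Finset.mem_of_mem_erase h)),
        Finset.card_erase_of_mem hx.1]
      omega
    let S' : {K : Finset α // IsKClique G m K} :=
      ⟨insert y (S.1.erase x), isKClique_of_subset hm hK hsub hc⟩
    have hadj : (percolationGraph G m).Adj S S' := by
      rw [percolationGraph_adj]
      have : S.1 ∩ S'.1 = S.1.erase x := by
        ext z
        simp only [S', Finset.mem_inter, Finset.mem_insert, Finset.mem_erase]
        constructor
        · rintro ⟨h, rfl | h'⟩
          · exact absurd h hy.2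
          · exact h'
        · exact fun h => ⟨h.2, Or.inr h⟩
      rw [this, Finset.card_erase_of_mem hx.1]
      omega
    refine hadj.reachable.trans (ih S' hsub ?_)
    have : S'.1 \ T.1 = (S.1 \ T.1).erase x := by
      ext z
      simp only [S', Finset.mem_sdiff, Finset.mem_insert, Finset.mem_erase]
      constructor
      · rintro ⟨rfl | h, h'⟩
        · exact absurd hy.1 h'
        · exact ⟨h.1, h.2, h'⟩
      · exact fun h => ⟨Or.inr ⟨h.1, h.2.1⟩, h.2.2⟩
    rw [this, Finset.card_erase_of_mem (Finset.mem_sdiff.2 hx)]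
    omega

/-- Some `m`-cliques inside `K` and `L` belong to the same community of order `m`. -/
def Linked (G : Network α) (m : ℕ) (K L : Finset α) : Prop :=
  ∃ S T : {K : Finset α // IsKClique G m K}, S.1 ⊆ K ∧ T.1 ⊆ L ∧
    (percolationGraph G m).Reachable S T

theorem Linked.symm {m : ℕ} {K L : Finset α} (h : Linked G m K L) : Linked G m L K := by
  obtain ⟨S, T, hS, hT, hr⟩ := h
  exact ⟨T, S, hT, hS, hr.symm⟩

theorem Linked.mono {m : ℕ} {K L K' L' : Finset α} (h : Linked G m K L) (hK : K ⊆ K')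
    (hL : L ⊆ L') : Linked G m K' L' := by
  obtain ⟨S, T, hS, hT, hr⟩ := h
  exact ⟨S, T, hS.trans hK, hT.trans hL, hr⟩

theorem Linked.reachable {m : ℕ} (hm : 2 ≤ m) {K L : Finset α} (h : Linked G m K L)
    (hK : G.spanningCoe.IsClique K) (hL : G.spanningCoe.IsClique L)
    (S T : {K : Finset α // IsKClique G m K}) (hS : S.1 ⊆ K) (hT : T.1 ⊆ L) :
    (percolationGraph G m).Reachable S T := by
  obtain ⟨S', T', hS', hT', hr⟩ := h
  exact (reachable_of_subset_isClique hm hK S S' hS hS').trans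
    (hr.trans (reachable_of_subset_isClique hm hL T' T hT' hT))

theorem Linked.trans {m : ℕ} (hm : 2 ≤ m) {K L M : Finset α} (h : Linked G m K L)
    (h' : Linked G m L M) (hL : G.spanningCoe.IsClique L) : Linked G m K M := by
  obtain ⟨S, T, hS, hT, hr⟩ := h
  obtain ⟨S', T', hS', hT', hr'⟩ := h'
  exact ⟨S, T', hS, hT', hr.trans ((reachable_of_subset_isClique hm hL T S' hT hS').trans hr')⟩

theorem Linked.le_card {m : ℕ} {K L : Finset α} (h : Linked G m K L) : m ≤ K.card := by
  obtain ⟨S, T, hS, hT, hr⟩ := h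
  exact S.2.2.card_eq ▸ Finset.card_le_card hS

theorem linked_self {m : ℕ} (hm : 2 ≤ m) {K : Finset α} (hK : G.spanningCoe.IsClique K)
    (hc : m ≤ K.card) : Linked G m K K := by
  obtain ⟨S, hS, hSc⟩ := Finset.exists_subset_card_eq hc
  exact ⟨⟨S, isKClique_of_subset hm hK hS hSc⟩, ⟨S, isKClique_of_subset hm hK hS hSc⟩, hS, hS,
    SimpleGraph.Reachable.refl _⟩

theorem isClique_sdiff [DecidableEq α] {V : Finset α}
    (hV : ∀ u v, u ∉ V → v ∉ V → G.Adj u v → G'.Adj u v) {K : Finset α}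
    (hK : G.spanningCoe.IsClique K) : G'.spanningCoe.IsClique (K \ V : Finset α) := by
  intro u hu v hv hne
  rw [Finset.mem_coe, Finset.mem_sdiff] at hu hv
  exact hV u v hu.2 hv.2 (hK hu.1 hv.1 hne)

theorem linked_sdiff_of_adj [DecidableEq α] {V : Finset α}
    (hV : ∀ u v, u ∉ V → v ∉ V → G.Adj u v → G'.Adj u v) {l m : ℕ} (hl : 2 ≤ l)
    (hlm : l + V.card ≤ m) {S T : {K : Finset α // IsKClique G m K}}
    (h : (percolationGraph G m).Adj S T) : Linked G' l (S.1 \ V) (T.1 \ V) := by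
  rw [percolationGraph_adj] at h
  have hS := isClique_sdiff hV S.2.2.isClique
  have hT := isClique_sdiff hV T.2.2.isClique
  have hcS : S.1.card - V.card ≤ (S.1 \ V).card := Finset.le_card_sdiff _ _
  have hcT : T.1.card - V.card ≤ (T.1 \ V).card := Finset.le_card_sdiff _ _
  have hcI : (S.1 ∩ T.1).card - V.card ≤ ((S.1 ∩ T.1) \ V).card := Finset.le_card_sdiff _ _
  rw [S.2.2.card_eq] at hcS
  rw [T.2.2.card_eq] at hcT
  have hIS : (S.1 ∩ T.1) \ V ⊆ S.1 \ V := Finset.sdiff_subset_sdiff Finset.inter_subset_left le_rfl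
  have hIT : (S.1 ∩ T.1) \ V ⊆ T.1 \ V := Finset.sdiff_subset_sdiff Finset.inter_subset_right le_rfl
  -- The rest of `S ∩ T` has at least l - 1 vertices. Either it contains an `l`-clique common to
  -- both sides, or it has exactly l - 1, and one further vertex on each side gives two adjacent
  -- `l`-cliques.
  by_cases hI : l ≤ ((S.1 ∩ T.1) \ V).card
  · exact (linked_self hl (hS.subset (Finset.coe_subset.2 hIS)) hI).mono hIS hIT
  · obtain ⟨x, hx, hxI⟩ := Finset.exists_mem_notMem_of_card_lt_card
      (by omega : ((S.1 ∩ T.1) \ V).card < (S.1 \ V).card)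
    obtain ⟨y, hy, hyI⟩ := Finset.exists_mem_notMem_of_card_lt_card
      (by omega : ((S.1 ∩ T.1) \ V).card < (T.1 \ V).card)
    have hsx : insert x ((S.1 ∩ T.1) \ V) ⊆ S.1 \ V := Finset.insert_subset hx hIS
    have hsy : insert y ((S.1 ∩ T.1) \ V) ⊆ T.1 \ V := Finset.insert_subset hy hIT
    refine ⟨⟨_, isKClique_of_subset hl hS hsx ?_⟩, ⟨_, isKClique_of_subset hl hT hsy ?_⟩, hsx, hsy,
      SimpleGraph.Adj.reachable (percolationGraph_adj.2 ?_)⟩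
    · rw [Finset.card_insert_of_notMem hxI]
      omega
    · rw [Finset.card_insert_of_notMem hyI]
      omega
    · have : insert x ((S.1 ∩ T.1) \ V) ∩ insert y ((S.1 ∩ T.1) \ V) = (S.1 ∩ T.1) \ V := by
        ext z
        simp only [Finset.mem_inter, Finset.mem_insert, Finset.mem_sdiff] at hx hy hxI hyI ⊢
        constructor
        · rintro ⟨rfl | h₁, rfl | h₂⟩
          · exact absurd ⟨⟨hx.1, hy.1⟩, hx.2⟩ hxI
          · exact h₂
          · exact h₁
          · exact h₁
        · exact fun h => ⟨Or.inr h, Or.inr h⟩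
      change (insert x ((S.1 ∩ T.1) \ V) ∩ insert y ((S.1 ∩ T.1) \ V)).card + 1 = l
      rw [this]
      omega

/-- When all edges of `G` outside of `V` are edges of `G'`, cliques of size `m` in one community
of `G` contain, outside of `V`, cliques of size `m - V.card` in one community of `G'`. -/
theorem linked_sdiff_of_reachable [DecidableEq α] {V : Finset α}
    (hV : ∀ u v, u ∉ V → v ∉ V → G.Adj u v → G'.Adj u v) {l m : ℕ} (hl : 2 ≤ l)
    (hlm : l + V.card ≤ m) {S T : {K : Finset α // IsKClique G m K}}
    (h : (percolationGraph G m).Reachable S T) : Linked G' l (S.1 \ V) (T.1 \ V) := by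
  obtain ⟨w⟩ := h
  induction w with
  | @nil S =>
    refine linked_self hl (isClique_sdiff hV S.2.2.isClique) ?_
    have := Finset.le_card_sdiff V S.1
    rw [S.2.2.card_eq] at this
    omega
  | @cons S S' T hadj _ ih =>
    exact (linked_sdiff_of_adj hV hl hlm hadj).trans hl ih (isClique_sdiff hV S'.2.2.isClique)

theorem Linked.sdiff [DecidableEq α] {V : Finset α}
    (hV : ∀ u v, u ∉ V → v ∉ V → G.Adj u v → G'.Adj u v) {l m : ℕ} (hl : 2 ≤ l)
    (hlm : l + V.card ≤ m) {K L : Finset α} (h : Linked G m K L) :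
    Linked G' l (K \ V) (L \ V) := by
  obtain ⟨S, T, hS, hT, hr⟩ := h
  exact (linked_sdiff_of_reachable hV hl hlm hr).mono (Finset.sdiff_subset_sdiff hS le_rfl)
    (Finset.sdiff_subset_sdiff hT le_rfl)

theorem Linked.of_le {l m : ℕ} (hl : 2 ≤ l) (hlm : l ≤ m) {K L : Finset α} (h : Linked G m K L) :
    Linked G l K L := by
  classical
  simpa using h.sdiff (V := ∅) (G' := G) (fun _ _ _ _ h => h) hl (by simpa using hlm)

end Linked

/-! ### The community tree as a merge tree -/

section Community

variable {α : Type u} {G : Network α}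

theorem Community.Nested.trans {C D E : Community G} (h : C.Nested D) (h' : D.Nested E)
    (hcard : ∀ K ∈ C.cliques, K.card = C.order) : C.Nested E := by
  refine ⟨h'.1.trans h.1, fun K hK L hL hLc => ?_⟩
  obtain ⟨M, hLM, hMK, hM⟩ := Finset.exists_subsuperset_card_eq hL (n := D.order)
    (by rw [hLc]; exact h'.1) (by rw [hcard K hK]; exact h.1)
  exact h'.2 M (h.2 K hK M hMK hM) L hLM hLc

theorem Community.isKClique {C : Community G} {K : Finset α} (hK : K ∈ C.cliques) :
    IsKClique G C.order K := by
  cases C with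
  | whole => exact hK
  | ofComponent k hk c =>
    obtain ⟨S, -, rfl⟩ := hK
    exact S.2

theorem Community.card_eq {C : Community G} {K : Finset α} (hK : K ∈ C.cliques) :
    K.card = C.order :=
  (Community.isKClique hK).2.card_eq

theorem Community.nested_refl (C : Community G) : C.Nested C := by
  refine ⟨le_rfl, fun K hK L hL hLc => ?_⟩
  rwa [Finset.eq_of_subset_of_card_le hL (by rw [hLc, Community.card_eq hK])]

theorem Community.one_le_order (C : Community G) : 1 ≤ C.order := by
  cases C with
  | whole => exact le_rfl
  | ofComponent k hk c => exact (Nat.le_succ 1).trans hk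

theorem Community.eq_ofComponent {C : Community G} {m : ℕ} (hm : 2 ≤ m) (hC : C.order = m)
    {S : {K : Finset α // IsKClique G m K}} (hS : S.1 ∈ C.cliques) :
    C = ofComponent m hm ((percolationGraph G m).connectedComponentMk S) := by
  cases C with
  | whole => change 1 = m at hC; omega
  | ofComponent k hk c =>
    change k = m at hC
    subst hC
    obtain ⟨S', hS', h⟩ := hS
    rw [Subtype.ext h] at hS'
    rw [SimpleGraph.ConnectedComponent.mem_supp_iff] at hS'
    rw [hS']

theorem Community.mem_cliques_ofComponent {m : ℕ} {hm : 2 ≤ m}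
    {S T : {K : Finset α // IsKClique G m K}} :
    T.1 ∈ (ofComponent m hm ((percolationGraph G m).connectedComponentMk S)).cliques ↔
      (percolationGraph G m).Reachable T S := by
  constructor
  · rintro ⟨T', hT', h⟩
    rw [Subtype.ext h] at hT'
    exact SimpleGraph.ConnectedComponent.eq.1 hT'
  · exact fun h => ⟨T, SimpleGraph.ConnectedComponent.eq.2 h, rfl⟩

theorem Community.reachable {C : Community G} (hC : 2 ≤ C.order) {K L : Finset α}
    (hK : K ∈ C.cliques) (hL : L ∈ C.cliques) :
    (percolationGraph G C.order).Reachable ⟨K, Community.isKClique hK⟩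
      ⟨L, Community.isKClique hL⟩ := by
  cases C with
  | whole => exact absurd hC (by change ¬ 2 ≤ 1; omega)
  | ofComponent k hk c =>
    obtain ⟨S, hS, rfl⟩ := hK
    obtain ⟨T, hT, rfl⟩ := hL
    exact SimpleGraph.ConnectedComponent.exact (hS.trans hT.symm)

theorem Community.exists_mem_cliques {C : Community G} (hC : 2 ≤ C.order) : ∃ K, K ∈ C.cliques := by
  cases C with
  | whole => exact absurd hC (by change ¬ 2 ≤ 1; omega)
  | ofComponent k hk c =>
    obtain ⟨S, hS⟩ := c.nonempty_supp
    exact ⟨S.1, S, hS, rfl⟩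

theorem Community.eq_whole {C : Community G} (hC : C.order < 2) : C = whole := by
  cases C with
  | whole => rfl
  | ofComponent k hk c => exact absurd hk (not_le.2 hC)

theorem Community.nested_whole (C : Community G) : C.Nested whole := by
  refine ⟨C.one_le_order, fun K hK L hL hLc => ?_⟩
  have h := Community.isKClique hK
  exact ⟨(Finset.coe_subset.2 hL).trans h.1, h.2.isClique.subset (Finset.coe_subset.2 hL), hLc⟩

theorem Community.Nested.eq {C D : Community G} (h : C.Nested D) (ho : C.order ≤ D.order) :
    C = D := by
  have ho' := le_antisymm ho h.1
  by_cases hC : 2 ≤ C.order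
  · obtain ⟨K, hK⟩ := Community.exists_mem_cliques hC
    rw [Community.eq_ofComponent (S := ⟨K, Community.isKClique hK⟩) hC rfl hK]
    exact (Community.eq_ofComponent hC ho'.symm
      (h.2 K hK K subset_rfl ((Community.card_eq hK).trans ho'))).symm
  · rw [Community.eq_whole (by omega : C.order < 2), Community.eq_whole (by omega : D.order < 2)]

/-- A community of order at least 2 is determined by any one of its cliques, whose size is its
order. -/
theorem finite_community (hG : G.verts.Finite) : Finite (Community G) := by
  classical
  have : Finite {K : Finset α // (K : Set α) ⊆ G.verts} := by
    refine Set.Finite.to_subtype ((Finset.finite_toSet (hG.toFinset.powerset)).subset ?_)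
    intro K hK
    rw [Finset.mem_coe, Finset.mem_powerset]
    exact fun v hv => hG.mem_toFinset.2 (hK hv)
  have h : ∀ C : Community G, ∃ K : Option {K : Finset α // (K : Set α) ⊆ G.verts},
      (C = .whole ∧ K = none) ∨ ∃ L, K = some L ∧ L.1 ∈ C.cliques ∧ 2 ≤ C.order := by
    intro C
    by_cases hC : 2 ≤ C.order
    · obtain ⟨K, hK⟩ := Community.exists_mem_cliques hC
      exact ⟨some ⟨K, (Community.isKClique hK).1⟩, Or.inr ⟨_, rfl, hK, hC⟩⟩
    · exact ⟨none, Or.inl ⟨Community.eq_whole (by omega), rfl⟩⟩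
  choose F hF using h
  refine Finite.of_injective F fun C D hCD => ?_
  rcases hF C with ⟨hC, hFC⟩ | ⟨L, hFC, hLC, hC⟩ <;> rcases hF D with ⟨hD, hFD⟩ | ⟨M, hFD, hMD, hD⟩
  · rw [hC, hD]
  · simp [hFC, hFD] at hCD
  · simp [hFC, hFD] at hCD
  · obtain rfl : L = M := by simpa [hFC, hFD] using hCD
    have ho : D.order = C.order := (Community.card_eq hMD).symm.trans (Community.card_eq hLC)
    rw [Community.eq_ofComponent (S := ⟨L.1, Community.isKClique hLC⟩) hC rfl hLC]
    exact (Community.eq_ofComponent hC ho hMD).symm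

theorem finite_leaf (hG : G.verts.Finite) : Finite (Leaf G) :=
  have := finite_community hG
  Subtype.finite

/-- Among the finitely many communities inside `C`, one of highest order is a leaf. -/
theorem exists_leaf_nested (hG : G.verts.Finite) (C : Community G) :
    ∃ a : Leaf G, a.1.Nested C := by
  have := finite_community hG
  obtain ⟨D, hD, hmax⟩ := (Set.toFinite {D : Community G | D.Nested C}).exists_maximalFor
    Community.order _ ⟨C, C.nested_refl⟩
  refine ⟨⟨D, fun E hE => hE.eq ?_⟩, hD⟩
  exact hmax (hE.trans hD fun K hK => Community.card_eq hK) hE.1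

/-- A clique that represents a component of the community tree. -/
theorem exists_clique_of_leaf (a : Leaf G) : ∃ K : Finset α, G.spanningCoe.IsClique K ∧
    birth a = max 1 K.card ∧ (2 ≤ birth a → K ∈ a.1.cliques) := by
  by_cases h : 2 ≤ birth a
  · obtain ⟨K, hK⟩ := Community.exists_mem_cliques h
    refine ⟨K, (Community.isKClique hK).2.isClique, ?_, fun _ => hK⟩
    rw [Community.card_eq hK]
    change birth a = max 1 (birth a)
    omega
  · have := a.1.one_le_order
    -- A leaf of order 1 is `whole`, and G may have no vertices, so the empty clique stands for it;
    -- hence the `max 1` in the birth time.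
    refine ⟨∅, by simp, ?_, fun h' => absurd h' h⟩
    change 1 ≤ birth a at this
    simp only [Finset.card_empty]
    omega

/-- A chosen clique of a leaf; its size is the birth time if this is at least `2`. -/
noncomputable def leafClique (a : Leaf G) : Finset α := (exists_clique_of_leaf a).choose

theorem isClique_leafClique (a : Leaf G) : G.spanningCoe.IsClique (leafClique a) :=
  (exists_clique_of_leaf a).choose_spec.1

theorem birth_eq (a : Leaf G) : birth a = max 1 (leafClique a).card :=
  (exists_clique_of_leaf a).choose_spec.2.1

theorem leafClique_mem (a : Leaf G) (h : 2 ≤ birth a) : leafClique a ∈ a.1.cliques :=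
  (exists_clique_of_leaf a).choose_spec.2.2 h

theorem mergeOrder_set_bddAbove (a b : Leaf G) :
    BddAbove {m | ∃ D : Community G, a.1.Nested D ∧ b.1.Nested D ∧ D.order = m} :=
  ⟨birth a, by rintro m ⟨D, hD, -, rfl⟩; exact hD.1⟩

theorem le_mergeOrder {a b : Leaf G} {D : Community G} (ha : a.1.Nested D) (hb : b.1.Nested D) :
    D.order ≤ mergeOrder a b :=
  le_csSup (mergeOrder_set_bddAbove a b) ⟨D, ha, hb, rfl⟩

theorem one_le_mergeOrder (a b : Leaf G) : 1 ≤ mergeOrder a b :=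
  le_mergeOrder a.1.nested_whole b.1.nested_whole

theorem exists_mergeOrder (a b : Leaf G) :
    ∃ D : Community G, a.1.Nested D ∧ b.1.Nested D ∧ D.order = mergeOrder a b :=
  Nat.sSup_mem (s := {m | ∃ D : Community G, a.1.Nested D ∧ b.1.Nested D ∧ D.order = m})
    ⟨1, .whole, a.1.nested_whole, b.1.nested_whole, rfl⟩
    (mergeOrder_set_bddAbove a b)

theorem nested_of_linked {m : ℕ} (hm : 2 ≤ m) {a : Leaf G}
    {S : {K : Finset α // IsKClique G m K}} (h : Linked G m (leafClique a) S.1) :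
    a.1.Nested (.ofComponent m hm ((percolationGraph G m).connectedComponentMk S)) := by
  have hmb : m ≤ birth a := h.le_card.trans (by rw [birth_eq]; exact le_max_right _ _)
  refine ⟨hmb, fun K hK L hL hLc => ?_⟩
  have hKc := Community.isKClique hK
  have hac := leafClique_mem a (hm.trans hmb)
  let T : {K : Finset α // IsKClique G m K} := ⟨L, isKClique_of_subset hm hKc.2.isClique hL hLc⟩
  refine Community.mem_cliques_ofComponent (T := T).2 ?_
  have hr := Community.reachable (hm.trans hmb) hK hac
  have hl : Linked G m K (leafClique a) :=
    Linked.of_le hm hmb ⟨_, _, subset_rfl, subset_rfl, hr⟩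
  exact (hl.trans hm h (isClique_leafClique a)).reachable hm hKc.2.isClique S.2.2.isClique T S hL
    subset_rfl

theorem linked_of_nested {m : ℕ} (hm : 2 ≤ m) {a : Leaf G}
    {S : {K : Finset α // IsKClique G m K}}
    (h : a.1.Nested (.ofComponent m hm ((percolationGraph G m).connectedComponentMk S))) :
    Linked G m (leafClique a) S.1 := by
  have hmb : m ≤ birth a := h.1
  obtain ⟨T, hT, hTc⟩ := Finset.exists_subset_card_eq
    (show m ≤ (leafClique a).card by rw [birth_eq] at hmb; omega)
  let T' : {K : Finset α // IsKClique G m K} :=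
    ⟨T, isKClique_of_subset hm (isClique_leafClique a) hT hTc⟩
  exact ⟨T', S, hT, subset_rfl, Community.mem_cliques_ofComponent.1
    (h.2 _ (leafClique_mem a (hm.trans hmb)) T hT hTc)⟩

/-- Translates merging in the tree into percolation between the two chosen cliques, where deleting
vertices can be analysed. -/
theorem le_mergeOrder_iff {m : ℕ} (hm : 2 ≤ m) {a b : Leaf G} :
    m ≤ mergeOrder a b ↔ Linked G m (leafClique a) (leafClique b) := by
  constructor
  · intro h
    obtain ⟨D, ha, hb, hD⟩ := exists_mergeOrder a b
    have hD2 : 2 ≤ D.order := by omega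
    obtain ⟨K, hK⟩ := Community.exists_mem_cliques hD2
    rw [Community.eq_ofComponent (S := ⟨K, Community.isKClique hK⟩) hD2 rfl hK] at ha hb
    exact ((linked_of_nested hD2 ha).trans hD2 (linked_of_nested hD2 hb).symm
      (Community.isKClique hK).2.isClique).of_le hm (by omega)
  · rintro ⟨S, T, hS, hT, hr⟩
    have ha : Linked G m (leafClique a) T.1 := ⟨S, T, hS, subset_rfl, hr⟩
    have hb : Linked G m (leafClique b) T.1 := ⟨T, T, hT, subset_rfl, .refl _⟩
    exact le_mergeOrder (nested_of_linked hm ha) (nested_of_linked hm hb)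

theorem isMergeTree (G : Network α) : IsMergeTree (birth (G := G)) mergeOrder where
  self a := le_antisymm
    (csSup_le ⟨1, .whole, a.1.nested_whole, a.1.nested_whole, rfl⟩ (by
      rintro m ⟨D, hD, -, rfl⟩; exact hD.1))
    (le_mergeOrder a.1.nested_refl a.1.nested_refl)
  symm a b := by
    unfold mergeOrder
    congr 1
    ext m
    exact exists_congr fun D => and_left_comm
  ultra a b c := by
    by_cases h : 2 ≤ min (mergeOrder a b) (mergeOrder b c)
    · exact (le_mergeOrder_iff h).2 (((le_mergeOrder_iff h).1 (min_le_left _ _)).trans h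
        ((le_mergeOrder_iff h).1 (min_le_right _ _)) (isClique_leafClique b))
    · have := one_le_mergeOrder a c
      omega
  pos := one_le_mergeOrder

/-! ### Interleaving the community trees -/

/-- A component of the tree of `G` is sent to a component of the tree of `G'` that contains the
rest of its clique outside of `V`. -/
theorem exists_leaf_map [DecidableEq α] {G G' : Network α} (hG' : G'.verts.Finite) {V : Finset α}
    (hV : ∀ u v, u ∉ V → v ∉ V → G.Adj u v → G'.Adj u v) {n : ℕ} (hn : V.card ≤ n) (a : Leaf G) :
    ∃ b : Leaf G', n + 2 ≤ birth a →
      Linked G' (birth a - n) (leafClique b) (leafClique a \ V) := by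
  by_cases h : n + 2 ≤ birth a
  · have hm : 2 ≤ birth a - n := by omega
    have hc := Finset.le_card_sdiff V (leafClique a)
    have hb := birth_eq a
    obtain ⟨S, hS, hSc⟩ := Finset.exists_subset_card_eq
      (show birth a - n ≤ (leafClique a \ V).card by omega)
    let S' : {K : Finset α // IsKClique G' (birth a - n) K} :=
      ⟨S, isKClique_of_subset hm (isClique_sdiff hV (isClique_leafClique a)) hS hSc⟩
    obtain ⟨b, hb⟩ := exists_leaf_nested hG' (.ofComponent (birth a - n) hm
      ((percolationGraph G' (birth a - n)).connectedComponentMk S'))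
    exact ⟨b, fun _ => (linked_of_nested hm hb).mono subset_rfl hS⟩
  · obtain ⟨b, -⟩ := exists_leaf_nested hG' .whole
    exact ⟨b, fun h' => absurd h' h⟩

theorem exists_interleaved [DecidableEq α] {G G' : Network α} (hG : G.verts.Finite)
    (hG' : G'.verts.Finite) {V : Finset α} (hV : ∀ u v, u ∉ V → v ∉ V → (G.Adj u v ↔ G'.Adj u v))
    {n : ℕ} (hn : V.card ≤ n) : ∃ (f : Leaf G → Leaf G') (g : Leaf G' → Leaf G),
      Interleaved n birth mergeOrder birth mergeOrder f g := by
  have key : ∀ {G G' : Network α}, (∀ u v, u ∉ V → v ∉ V → G.Adj u v → G'.Adj u v) →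
      (∀ u v, u ∉ V → v ∉ V → G'.Adj u v → G.Adj u v) →
      ∀ {f : Leaf G → Leaf G'} {g : Leaf G' → Leaf G},
      (∀ a, n + 2 ≤ birth a → Linked G' (birth a - n) (leafClique (f a)) (leafClique a \ V)) →
      (∀ b, n + 2 ≤ birth b → Linked G (birth b - n) (leafClique (g b)) (leafClique b \ V)) →
      (∀ a, birth a ≤ birth (f a) + n) ∧
      (∀ a a', mergeOrder a a' ≤ mergeOrder (f a) (f a') + n) ∧
      (∀ a, birth a ≤ mergeOrder a (g (f a)) + 2 * n) := by
    intro G G' h h' f g hf hg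
    have hb : ∀ a, birth a ≤ birth (f a) + n := by
      intro a
      by_cases ha : n + 2 ≤ birth a
      · have := (hf a ha).le_card
        have := birth_eq (f a)
        omega
      · have := (isMergeTree G').one_le_birth (f a)
        omega
    refine ⟨hb, fun a a' => ?_, fun a => ?_⟩
    · by_cases hm : n + 2 ≤ mergeOrder a a'
      · have hl := (le_mergeOrder_iff (by omega)).1 (le_refl (mergeOrder a a'))
        have ha := (isMergeTree G).le_birth_left (le_refl (mergeOrder a a'))
        have ha' := (isMergeTree G).le_birth_left
          ((isMergeTree G).le_symm (le_refl (mergeOrder a a')))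
        have h2 : 2 ≤ mergeOrder a a' - n := by omega
        have h₁ := (hf a (by omega)).of_le h2 (by omega)
        have h₂ := (hf a' (by omega)).of_le h2 (by omega)
        have h₃ := hl.sdiff h h2 (by omega)
        have := (le_mergeOrder_iff h2).2 ((h₁.trans h2 h₃
          (isClique_sdiff h (isClique_leafClique a))).trans h2 h₂.symm
            (isClique_sdiff h (isClique_leafClique a')))
        omega
      · have := one_le_mergeOrder (f a) (f a')
        omega
    · by_cases hm : 2 * n + 2 ≤ birth a
      · have h2 : 2 ≤ birth a - 2 * n := by omega
        have hfa := hb a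
        have h₁ := (hg (f a) (by omega)).of_le h2 (by omega)
        have h₂ := ((hf a (by omega)).sdiff h' h2 (by omega)).mono subset_rfl
          (Finset.sdiff_subset.trans Finset.sdiff_subset)
        have := (le_mergeOrder_iff h2).2 (h₁.trans h2 h₂
          (isClique_sdiff h' (isClique_leafClique (f a)))).symm
        omega
      · have := one_le_mergeOrder a (g (f a))
        omega
  choose f hf using exists_leaf_map hG' (fun u v hu hv => (hV u v hu hv).1) hn
  choose g hg using exists_leaf_map hG (fun u v hu hv => (hV u v hu hv).2) hn
  obtain ⟨h₁, h₂, h₃⟩ := key (fun u v hu hv => (hV u v hu hv).1)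
    (fun u v hu hv => (hV u v hu hv).2) hf hg
  obtain ⟨h₄, h₅, h₆⟩ := key (fun u v hu hv => (hV u v hu hv).2)
    (fun u v hu hv => (hV u v hu hv).1) hg hf
  exact ⟨f, g, h₁, h₄, h₂, h₅, h₃, h₆⟩

theorem exists_card_eq_RSN (G' : Network α) (hG : G.verts.Finite) : ∃ V : Finset α,
    V.card = RSN G' G ∧ ∀ e ∈ G.edgeSet \ G'.edgeSet, ∃ v ∈ V, v ∈ e := by
  refine Nat.sInf_mem (s := {n | ∃ V₀ : Finset α, V₀.card = n ∧
    ∀ e ∈ G.edgeSet \ G'.edgeSet, ∃ v ∈ V₀, v ∈ e}) ⟨_, hG.toFinset, rfl, fun e he => ?_⟩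
  induction e with
  | _ u v =>
    exact ⟨u, hG.mem_toFinset.2 (G.edge_vert (SimpleGraph.Subgraph.mem_edgeSet.1 he.1)),
      Sym2.mem_mk_left u v⟩

theorem adj_of_notMem {G G' : Network α} {V : Finset α}
    (hV : ∀ e ∈ G.edgeSet \ G'.edgeSet, ∃ v ∈ V, v ∈ e) {u v : α} (hu : u ∉ V) (hv : v ∉ V)
    (h : G.Adj u v) : G'.Adj u v := by
  by_contra h'
  obtain ⟨w, hw, hwe⟩ := hV s(u, v) ⟨h, h'⟩
  rcases Sym2.mem_iff.1 hwe with rfl | rfl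
  · exact hu hw
  · exact hv hw

end Community

end CommunityTree

/-! ### Conclusion -/

theorem theorem1 {α : Type*} (G G' : CommunityTree.Network α)
    (hG : G.verts.Finite) (hG' : G'.verts.Finite)
    (elder : CommunityTree.Leaf G → CommunityTree.Leaf G → Prop)
    (helder : CommunityTree.IsElderRule G elder)
    (elder' : CommunityTree.Leaf G' → CommunityTree.Leaf G' → Prop)
    (helder' : CommunityTree.IsElderRule G' elder') :
    CommunityTree.bottleneckDist (CommunityTree.diagramPoint G elder)
      (CommunityTree.diagramPoint G' elder') ≤ (CommunityTree.TSN G' G : ENNReal) := by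
  classical
  have := CommunityTree.finite_leaf hG
  have := CommunityTree.finite_leaf hG'
  obtain ⟨V, hVc, hV⟩ := CommunityTree.exists_card_eq_RSN G' hG
  obtain ⟨W, hWc, hW⟩ := CommunityTree.exists_card_eq_RSN G hG'
  have hc : (V ∪ W).card ≤ CommunityTree.TSN G' G := by
    refine (Finset.card_union_le V W).trans (le_of_eq ?_)
    rw [hVc, hWc]
    rfl
  obtain ⟨f, g, hI⟩ := CommunityTree.exists_interleaved hG hG' (V := V ∪ W)
    (fun u v hu hv => by
      rw [Finset.notMem_union] at hu hv
      exact ⟨CommunityTree.adj_of_notMem hV hu.1 hv.1, CommunityTree.adj_of_notMem hW hu.2 hv.2⟩) hc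
  have hm := CommunityTree.isMergeTree G
  have hm' := CommunityTree.isMergeTree G'
  obtain ⟨R, hr, hl, hR, hp, hq⟩ := hI.exists_matching hm hm' ⟨helder.1, helder.2⟩
    ⟨helder'.1, helder'.2⟩
  refine CommunityTree.bottleneckDist_le_of_matching _ _ _ R hr hl (fun a b h => ?_)
    (fun a h => ?_) (fun b h => ?_)
  · obtain ⟨h₁, h₂, h₃, h₄⟩ := hR a b h
    have h₁' := (Nat.cast_le (α := ℝ)).2 h₁
    have h₂' := (Nat.cast_le (α := ℝ)).2 h₂
    have h₃' := (Nat.cast_le (α := ℝ)).2 h₃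
    have h₄' := (Nat.cast_le (α := ℝ)).2 h₄
    push_cast at h₁' h₂' h₃' h₄'
    rw [Prod.dist_eq, Real.dist_eq, Real.dist_eq]
    -- `death` is by definition `elderDeath` for `mergeOrder`.
    change max |(CommunityTree.elderDeath CommunityTree.mergeOrder elder a : ℝ) -
      (CommunityTree.elderDeath CommunityTree.mergeOrder elder' b : ℝ)|
      |(CommunityTree.birth a : ℝ) - (CommunityTree.birth b : ℝ)| ≤ _
    exact max_le (abs_le.2 ⟨by linarith, by linarith⟩) (abs_le.2 ⟨by linarith, by linarith⟩)
  · have h₁ := (Nat.cast_le (α := ℝ)).2 (hp a h)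
    have h₂ := (Nat.cast_le (α := ℝ)).2
      (CommunityTree.elderDeath_le_birth (elder := elder) hm a)
    push_cast at h₁
    exact ⟨h₂, h₁⟩
  · have h₁ := (Nat.cast_le (α := ℝ)).2 (hq b h)
    have h₂ := (Nat.cast_le (α := ℝ)).2
      (CommunityTree.elderDeath_le_birth (elder := elder') hm' b)
    push_cast at h₁
    exact ⟨h₂, h₁⟩
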